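/- Conventions. A Coxeter matrix over a (possibly infinite) set $I$ is a symmetric family $\Gamma=(m_{i,j})_{i,j\in I}$ in $\mathbb{N}_{\geq 1}\cup\{\infty\}$ with $m_{i,j}=1\Leftrightarrow i=j$; $W_\Gamma$ is its Coxeter group, with generators $s_i$ ($i\in I$) and standard length $\ell$. Its Coxeter graph has vertex set $I$ and an edge $\{i,j\}$ whenever $m_{i,j}\geq 3$, labelled by $m_{i,j}$ when $m_{i,j}\geq 4$. For $J\subseteq I$ put $W_J=\langle s_j\mid j\in J\rangle$, and call $J$ spherical if $W_J$ is finite; then $r_J$ denotes the unique element of maximal length of $W_J$. A partition $\tilde I$ of $I$ is spherical if all its parts are spherical; its type is then the matrix $(|r_\alpha r_\beta|)_{\alpha,\beta\in\tilde I}$ of the orders of the products $r_\alpha r_\beta$ in $W_\Gamma$. It is admissible if it is spherical and, for every $w$ in the subgroup $\langle r_\alpha\mid\alpha\in\tilde I\rangle$ of $W_\Gamma$ and every $\alpha\in\tilde I$, either $\ell(ws_i)=\ell(w)+1$ for all $i\in\alpha$, or $\ell(ws_i)=\ell(w)-1$ for all $i\in\alpha$. Bursts. For $m\in\mathbb{N}_{\geq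 2}\cup\{\infty\}$ let $\delta(m)=m-1$ if $m$ is even, $\delta(m)=\frac{m-1}{2}$ if $m$ is odd, and $\delta(\infty)=2$. Let $G_m$ be the bipartite graph with vertices $\bullet_1,\dots,\bullet_{\delta(m)}$ and $\circ_1,\dots,\circ_{\delta(m)}$ in which $\bullet_k$ and $\circ_l$ are joined exactly when: $|k-l|=1$, if $m$ is even; $k\in\{l,l+1\}$, if $m$ is odd; always, if $m=\infty$. Let $\Gamma=(m_{i,j})_{i,j\in I}$ be a Coxeter matrix such that the set $\{m_{i,j}\mid i,j\in I\}$ is finite, let $N_0=\operatorname{lcm}\{\delta(m_{i,j})\mid i,j\in I,\ i\neq j\}$, and let $N\geq 1$ be a multiple of $N_0$. An $N$-burst of $\Gamma$ is a Coxeter graph $\widehat\Gamma$ without labelled edges (all entries of its Coxeter matrix lie in $\{1,2,3\}$), whose vertex set is a disjoint union $\widehat I=\bigsqcup_{i\in I}T(i)$ of sets of cardinality $N$, such that there is no edge inside any $T(i)$ and, for all $i\neq j$, the subgraph of $\widehat\Gamma$ induced on $T(i)\sqcup T(j)$ is the disjoint union of $N/\delta(m_{i,j})$ copies of $G_{m_{i,j}}$,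 where the vertices $\bullet$ constitute $T(i)$ and the vertices $\circ$ constitute $T(j)$. Theorem. Let $\Gamma=(m_{i,j})_{i,j\in I}$ be a Coxeter matrix with $\{m_{i,j}\mid i,j\in I\}$ finite, and let $\widehat\Gamma$ be an $N$-burst of $\Gamma$. Then the partition $\{T(i)\mid i\in I\}$ of $\widehat I$ is an admissible partition of $\widehat\Gamma$, and its type is isomorphic to $\Gamma$ via $i\mapsto T(i)$; that is, $i\mapsto T(i)$ is a bijection from $I$ onto the partition and the order of $r_{T(i)}r_{T(j)}$ in $W_{\widehat\Gamma}$ is $m_{i,j}$ for all $i,j\in I$. -/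

import Mathlib

/-! Throughout, a Coxeter matrix is Mathlib's `CoxeterMatrix`, where the entry `0` stands for the
label `∞`; correspondingly `orderOf g = 0` means that `g` has infinite order. -/

namespace CoxeterMatrix

variable {V : Type*}

/-- The standard length `ℓ` on the Coxeter group of `Γ`. -/
noncomputable def len (Γ : CoxeterMatrix V) (w : Γ.Group) : ℕ :=
  Γ.toCoxeterSystem.length w

/-- The standard parabolic subgroup `W_J` generated by the `s_j`, `j ∈ J`. -/
def parabolic (Γ : CoxeterMatrix V) (J : Set V) : Subgroup Γ.Group :=
  Subgroup.closure (Γ.simple '' J)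

/-- `J` is spherical: the group `W_J` is finite. -/
def IsSpherical (Γ : CoxeterMatrix V) (J : Set V) : Prop :=
  Finite (Γ.parabolic J)

/-- `w` is an element of maximal standard length in `W_J`. -/
def IsLongest (Γ : CoxeterMatrix V) (J : Set V) (w : Γ.Group) : Prop :=
  w ∈ Γ.parabolic J ∧ ∀ v ∈ Γ.parabolic J, Γ.len v ≤ Γ.len w

/-- The element `r_J` of maximal standard length in `W_J` (for `J` spherical, it exists and is
unique). -/
noncomputable def longest (Γ : CoxeterMatrix V) (J : Set V) : Γ.Group :=
  Classical.epsilon (Γ.IsLongest J)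

/-- For spherical `J` the element `r_J` does have maximal length in `W_J`. -/
theorem IsSpherical.isLongest_longest {Γ : CoxeterMatrix V} {J : Set V} (h : Γ.IsSpherical J) :
    Γ.IsLongest J (Γ.longest J) := by
  have : Finite (Γ.parabolic J) := h
  obtain ⟨x, hx⟩ := Finite.exists_max (fun v : Γ.parabolic J => Γ.len v)
  exact Classical.epsilon_spec (p := Γ.IsLongest J) ⟨x, x.2, fun v hv => hx ⟨v, hv⟩⟩

/-- `P` is a spherical partition of the vertex set. -/
def IsSphericalPartition (Γ : CoxeterMatrix V) (P : Set (Set V)) : Prop :=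
  Setoid.IsPartition P ∧ ∀ α ∈ P, Γ.IsSpherical α

/-- The subgroup `W̃` generated by the `r_α`, `α ∈ P`. -/
def foldedGroup (Γ : CoxeterMatrix V) (P : Set (Set V)) : Subgroup Γ.Group :=
  Subgroup.closure (Γ.longest '' P)

/-- `I⁺(w)`. -/
def ascents (Γ : CoxeterMatrix V) (w : Γ.Group) : Set V :=
  {i | Γ.len (w * Γ.simple i) = Γ.len w + 1}

/-- `I⁻(w)`. -/
def descents (Γ : CoxeterMatrix V) (w : Γ.Group) : Set V :=
  {i | Γ.len (w * Γ.simple i) + 1 = Γ.len w}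

/-- `P` is an admissible partition of `Γ`. -/
def IsAdmissible (Γ : CoxeterMatrix V) (P : Set (Set V)) : Prop :=
  Γ.IsSphericalPartition P ∧
    ∀ w ∈ Γ.foldedGroup P, ∀ α ∈ P, α ⊆ Γ.ascents w ∨ α ⊆ Γ.descents w

/-- The type of a spherical partition `P`: the matrix of the orders of the products `r_α r_β`. -/
noncomputable def partitionType (Γ : CoxeterMatrix V) (P : Set (Set V)) : Matrix P P ℕ :=
  fun α β => orderOf (Γ.longest α * Γ.longest β)

end CoxeterMatrix

namespace CoxeterMatrix

variable {I V : Type*}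

/-- The set of labels `{m_{i,j} | i, j ∈ I}`. -/
def labels (Γ : CoxeterMatrix I) : Set ℕ := {m | ∃ i j, Γ i j = m}

/-- The function `δ`, with `δ(∞) = 2` (and `∞` encoded as `0`). -/
def burstDelta (m : ℕ) : ℕ :=
  if m = 0 then 2 else if Even m then m - 1 else (m - 1) / 2

open Classical in
/-- `N₀ = lcm {δ(m_{i,j}) | i ≠ j}`. -/
noncomputable def burstLcm (Γ : CoxeterMatrix I) (hΓ : Γ.labels.Finite) : ℕ :=
  (hΓ.toFinset.filter fun m => ∃ i j, i ≠ j ∧ Γ i j = m).lcm burstDelta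

/-- The bipartite graph with vertices `•₀, …, •_{δ(m)-1}` and `∘₀, …, ∘_{δ(m)-1}` attached to the
label `m`: `burstBlock m k l` says that `•ₖ` and `∘ₗ` are joined by an edge. -/
def burstBlock (m k l : ℕ) : Prop :=
  if m = 0 then True
  else if Even m then k = l + 1 ∨ l = k + 1
  else k = l ∨ k = l + 1

/-- The set `T(i)`, for a vertex set `V` decomposed as a disjoint union of sets indexed by `I`
according to the map `p : V → I`. -/
def burstFiber (p : V → I) (i : I) : Set V := {v | p v = i}

open Classical in
/-- `Γ'` is an `N`-burst of `Γ`, its vertex set `V` being the disjoint union of the sets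
`T(i) = p⁻¹(i)`. Between `T(i)` and `T(j)`, the graph is a disjoint union of `N / δ(m_{i,j})` copies
of the bipartite graph `burstBlock m_{i,j}`, with `•` in `T(i)` and `∘` in `T(j)`; the bijections
`e`, `f` send a vertex to (number of its copy, number in the copy). All edges have label `3`. -/
structure IsBurst (Γ : CoxeterMatrix I) (hΓ : Γ.labels.Finite) (N : ℕ)
    (Γ' : CoxeterMatrix V) (p : V → I) : Prop where
  pos : 0 < N
  dvd : Γ.burstLcm hΓ ∣ N
  card : ∀ i, Nat.card (burstFiber p i) = N
  within : ∀ x y, x ≠ y → p x = p y → Γ' x y = 2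
  between : ∀ i j, i ≠ j →
    ∃ e : burstFiber p i ≃ Fin (N / burstDelta (Γ i j)) × Fin (burstDelta (Γ i j)),
    ∃ f : burstFiber p j ≃ Fin (N / burstDelta (Γ i j)) × Fin (burstDelta (Γ i j)),
      ∀ (x : burstFiber p i) (y : burstFiber p j),
        Γ' x y = if (e x).1 = (f y).1 ∧ burstBlock (Γ i j) (e x).2 (f y).2 then 3 else 2

end CoxeterMatrix

/-! Let `W_Γ'` act on functions `V → ℤ` by the numbers game: firing `x` negates the value at `x` and
adds its old value to the neighbours. If `f` is regarded as a linear form on the root lattice, the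
value of `w⁻¹ f` at `x` is `f(w α_x)`; so for positive `f` its sign says whether `x` is an ascent or
a descent of `w` (`pos_of_len_lt`, `neg_of_len_lt`). The longest element of an independent set `X`
fires all of `X` at once (`act_longest`).

Alternate firing of `T(i)` and `T(j)` is governed by Chebyshev polynomials `U_k` in the adjacency
matrix of the graph on `T(i) ∪ T(j)` (`game_eq_sum_kernel`). For `m = m_{i,j}` finite this graph is
a union of paths with `m - 1` vertices, where the `U_k` with `k < m` have nonnegative entries
(fusion coefficients of SU(2)) and `U_{m-1}` vanishes; for `m = ∞` it is a union of 4-cycles, where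
all `U_k` are nonnegative.

Vanishing gives the braid relations, hence a homomorphism `hom : W_Γ → W_Γ'` with `s_i ↦ r_{T(i)}`.
Nonnegativity says that alternating products with fewer than `m` factors preserve positivity on the
set not fired last. By induction on length in `W_Γ` (`pos_of_ascent`), an ascent or descent `i` of
`u` makes `(hom u)⁻¹ 1` positive or negative on all of `T(i)`: this is admissibility. The same sign
rule bounds the orders of `r_{T(i)} r_{T(j)}` from below. -/

/-- The product of `k` alternating factors `a` and `b`, the last one being `b`. -/
def altProd {G : Type*} [Monoid G] : G → G → ℕ → G
  | _, _, 0 => 1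
  | a, b, k + 1 => altProd b a k * b

/-! ### Alternating products of two involutions -/

section altProd

variable {G H : Type*}

theorem map_altProd [Monoid G] [Monoid H] (φ : G →* H) (a b : G) (k : ℕ) :
    φ (altProd a b k) = altProd (φ a) (φ b) k := by
  induction k generalizing a b with
  | zero => simp [altProd]
  | succ k ih => simp [altProd, ih]

theorem altProd_add [Monoid G] (a b : G) (k m : ℕ) :
    altProd a b (k + m) = (if Even m then altProd a b k else altProd b a k) * altProd a b m := by
  induction m generalizing a b with
  | zero => simp [altProd]
  | succ m ih =>
    rw [← add_assoc, altProd, ih, altProd, mul_assoc]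
    by_cases h : Even m <;> simp [h, Nat.even_add_one]

theorem altProd_two_mul [Monoid G] (a b : G) (k : ℕ) : altProd a b (2 * k) = (a * b) ^ k := by
  induction k with
  | zero => simp [altProd]
  | succ k ih => rw [Nat.mul_succ, altProd, altProd, ih, pow_succ, mul_assoc]

theorem altProd_two_mul_add_one [Monoid G] (a b : G) (k : ℕ) :
    altProd a b (2 * k + 1) = (b * a) ^ k * b := by
  rw [altProd, altProd_two_mul]

/-- Since `b * a = (a * b)⁻¹`, the quotient of the two alternating products is `(a * b) ^ m` or its
inverse. -/
theorem altProd_comm_iff [Group G] {a b : G} (ha : a * a = 1) (hb : b * b = 1) (m : ℕ) :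
    altProd a b m = altProd b a m ↔ (a * b) ^ m = 1 := by
  have hab : (b * a) = (a * b)⁻¹ := by
    rw [mul_inv_rev, ← eq_inv_of_mul_eq_one_left ha, ← eq_inv_of_mul_eq_one_left hb]
  rcases Nat.even_or_odd' m with ⟨k, rfl | rfl⟩
  · rw [altProd_two_mul, altProd_two_mul, hab, inv_pow, eq_inv_iff_mul_eq_one, ← pow_add, two_mul]
  · rw [altProd_two_mul_add_one, altProd_two_mul_add_one, hab, inv_pow, inv_mul_eq_iff_eq_mul,
      ← mul_assoc, ← pow_add, eq_comm, ← eq_mul_inv_iff_mul_eq,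
      ← eq_inv_of_mul_eq_one_left ha, hab, eq_inv_iff_mul_eq_one, ← pow_succ, two_mul]

end altProd

namespace CoxeterMatrix

variable {I V : Type*}

/-! ### Lengths in a Coxeter group and reduction to rank two -/

theorem len_altProd_le (M : CoxeterMatrix I) (i j : I) (k : ℕ) :
    M.len (altProd (M.simple i) (M.simple j) k) ≤ k := by
  induction k generalizing i j with
  | zero => simp [altProd, len]
  | succ k ih =>
    refine (M.toCoxeterSystem.length_mul_le _ _).trans ?_
    have h1 : M.toCoxeterSystem.length (M.simple j) = 1 := M.toCoxeterSystem.length_simple j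
    rw [h1]
    exact Nat.add_le_add_right (ih j i) 1

theorem simple_mul_self (M : CoxeterMatrix I) (i : I) : M.simple i * M.simple i = 1 :=
  M.toCoxeterSystem.simple_mul_simple_self i

theorem altProd_simple_comm (M : CoxeterMatrix I) (i j : I) :
    altProd (M.simple i) (M.simple j) (M i j) = altProd (M.simple j) (M.simple i) (M i j) :=
  (altProd_comm_iff (M.simple_mul_self i) (M.simple_mul_self j) _).2
    (M.toCoxeterSystem.simple_mul_simple_pow i j)

theorem len_mul_le (M : CoxeterMatrix I) (u v : M.Group) : M.len (u * v) ≤ M.len u + M.len v :=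
  M.toCoxeterSystem.length_mul_le u v

theorem len_mul_simple (M : CoxeterMatrix I) (w : M.Group) (i : I) :
    M.len (w * M.simple i) = M.len w + 1 ∨ M.len (w * M.simple i) + 1 = M.len w :=
  M.toCoxeterSystem.length_mul_simple w i

theorem mul_simple_cancel (M : CoxeterMatrix I) (w : M.Group) (i : I) :
    w * M.simple i * M.simple i = w := by
  rw [mul_assoc, simple_mul_self, mul_one]

theorem exists_descent (M : CoxeterMatrix I) {w : M.Group} (hw : w ≠ 1) :
    ∃ i, M.len (w * M.simple i) < M.len w :=
  M.toCoxeterSystem.exists_rightDescent_of_ne_one hw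

/-- An element with ascent `i` and descent `j` is the product, with lengths adding up, of an element
with ascents `i` and `j` and a nontrivial alternating product of `s_i` and `s_j` with fewer than
`m_{i,j}` factors that ends in `s_j`. -/
theorem exists_eq_mul_altProd (M : CoxeterMatrix I) {u : M.Group} {i j : I}
    (hi : M.len u < M.len (u * M.simple i)) (hj : M.len (u * M.simple j) < M.len u) :
    ∃ v k, u = v * altProd (M.simple i) (M.simple j) k ∧ M.len v < M.len u ∧
      (M i j = 0 ∨ k < M i j) ∧ M.len v < M.len (v * M.simple i) ∧
      M.len v < M.len (v * M.simple j) := by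
  classical
  -- Split off the longest alternating suffix ending in `s_j` along which lengths add up.
  let P : ℕ → Prop := fun k =>
    ∃ v, u = v * altProd (M.simple i) (M.simple j) k ∧ M.len v + k = M.len u
  have hP1 : P 1 := ⟨u * M.simple j, by simp [altProd, mul_simple_cancel], by
    rcases M.len_mul_simple u j with h | h <;> omega⟩
  have h1 : 1 ≤ M.len u := by omega
  obtain ⟨v, huv, hlen⟩ : P (Nat.findGreatest P (M.len u)) := Nat.findGreatest_spec h1 hP1
  have hk1 : 1 ≤ Nat.findGreatest P (M.len u) := Nat.le_findGreatest h1 hP1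
  have hmax : ∀ l, Nat.findGreatest P (M.len u) < l → ¬ P l := by
    intro l hl hPl
    obtain ⟨v', _, hv'⟩ := id hPl
    exact Nat.findGreatest_is_greatest hl (by omega) hPl
  generalize Nat.findGreatest P (M.len u) = k at *
  obtain ⟨k, rfl⟩ : ∃ l, k = l + 1 := ⟨k - 1, by omega⟩
  have hfirst : M.len v < M.len (v * M.simple (if Even k then j else i)) := by
    by_contra hlt
    have hl : M.len (v * M.simple (if Even k then j else i)) + 1 = M.len v := by
      rcases M.len_mul_simple v (if Even k then j else i) with h | h <;> omega
    have : u = v * M.simple (if Even k then j else i) *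
        altProd (M.simple i) (M.simple j) k := by
      rw [huv, add_comm k 1, altProd_add, ← mul_assoc]
      by_cases h : Even k <;> simp [h, altProd]
    have h2 := M.len_mul_le (v * M.simple (if Even k then j else i))
      (altProd (M.simple i) (M.simple j) k)
    rw [← this] at h2
    have := M.len_altProd_le i j k
    omega
  -- A descent here would prolong the suffix, against maximality.
  have hnext : M.len v < M.len (v * M.simple (if Even k then i else j)) := by
    by_contra hlt
    have hl : M.len (v * M.simple (if Even k then i else j)) + 1 = M.len v := by
      rcases M.len_mul_simple v (if Even k then i else j) with h | h <;> omega
    refine hmax (k + 1 + 1) (by omega) ⟨v * M.simple (if Even k then i else j), ?_, by omega⟩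
    rw [huv]
    conv_rhs => rw [add_comm (k + 1) 1, altProd_add]
    by_cases h : Even k <;>
      simp [h, altProd, Nat.even_add_one, ← mul_assoc, mul_simple_cancel]
  refine ⟨v, k + 1, huv, by omega, ?_, ?_, ?_⟩
  -- With at least `m_{i,j}` factors, the braid relation turns the end of the suffix into a word
  -- ending in `s_i`, so `u * s_i` would be shorter than `u`.
  · by_contra! hcon
    obtain ⟨hm0, hmk⟩ := hcon
    obtain ⟨m, hm⟩ : ∃ m, M i j = m + 1 := ⟨M i j - 1, by omega⟩
    obtain ⟨r, hr⟩ : ∃ r, k + 1 = r + M i j := ⟨k + 1 - M i j, by omega⟩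
    have hbraid := M.altProd_simple_comm i j
    have key : u * M.simple i = v *
        ((if Even (M i j) then altProd (M.simple i) (M.simple j) r else
          altProd (M.simple j) (M.simple i) r) * altProd (M.simple i) (M.simple j) m) := by
      rw [huv, hr, altProd_add, hbraid]
      conv_lhs => rw [hm]
      rw [altProd, ← hm]
      simp only [mul_assoc, simple_mul_self, mul_one]
    have l1 := M.len_mul_le v ((if Even (M i j) then altProd (M.simple i) (M.simple j) r else
          altProd (M.simple j) (M.simple i) r) * altProd (M.simple i) (M.simple j) m)
    have l2 := M.len_mul_le (if Even (M i j) then altProd (M.simple i) (M.simple j) r else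
          altProd (M.simple j) (M.simple i) r) (altProd (M.simple i) (M.simple j) m)
    have l3 : M.len (if Even (M i j) then altProd (M.simple i) (M.simple j) r else
          altProd (M.simple j) (M.simple i) r) ≤ r := by
      split_ifs <;> apply len_altProd_le
    have l4 := M.len_altProd_le i j m
    rw [← key] at l1
    omega
  · by_cases h : Even k
    · simpa [h] using hnext
    · simpa [h] using hfirst
  · by_cases h : Even k
    · simpa [h] using hfirst
    · simpa [h] using hnext

/-- If the alternating products of two generators with fewer than `m_{i,j}` factors preserve
positivity, then so do all elements of the Coxeter group, on the coordinates above an ascent. -/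
theorem pos_of_ascent (M : CoxeterMatrix I) (ψ : M.Group →* Equiv.Perm (V → ℤ)) (p : V → I)
    (h2 : ∀ i j, i ≠ j → ∀ k, (M i j = 0 ∨ k < M i j) → ∀ f : V → ℤ,
      (∀ y, p y = i ∨ p y = j → 0 < f y) → ∀ x, p x = i →
        0 < ψ (altProd (M.simple i) (M.simple j) k)⁻¹ f x)
    {f : V → ℤ} (hf : ∀ x, 0 < f x) {u : M.Group} {i : I}
    (hi : M.len u < M.len (u * M.simple i)) {x : V} (hx : p x = i) : 0 < ψ u⁻¹ f x := by
  induction hn : M.len u using Nat.strong_induction_on generalizing u i x with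
  | _ n ih =>
    subst hn
    by_cases hu : u = 1
    · simpa [hu] using hf x
    obtain ⟨j, hj⟩ := M.exists_descent hu
    obtain ⟨v, k, huv, hv, hk, hvi, hvj⟩ := M.exists_eq_mul_altProd hi hj
    have hij : i ≠ j := by
      rintro rfl
      omega
    -- In `u⁻¹` the inverse of `v` acts first; as `v` is shorter and has both ascents, induction
    -- gives the positivity over `i` and `j` that `h2` requires.
    rw [huv, mul_inv_rev, map_mul, Equiv.Perm.mul_apply]
    refine h2 i j hij k hk _ ?_ x hx
    rintro y (hy | hy)
    · exact ih _ hv hvi hy rfl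
    · exact ih _ hv hvj hy rfl

/-! ### The numbers game -/

open Classical in
/-- The move of the numbers game on functions `f : V → ℤ` that fires all vertices of `X` at once:
the values on `X` change sign, and are added to the values at their neighbours outside `X`. -/
noncomputable def fire (Γ : CoxeterMatrix V) (X : Finset V) (f : V → ℤ) : V → ℤ :=
  fun y => if y ∈ X then -f y else f y + ∑ x ∈ X with Γ x y = 3, f x

/-- No two vertices of `X` are joined by an edge labelled `3`. -/
def IsIndep (Γ : CoxeterMatrix V) (X : Finset V) : Prop :=
  ∀ x ∈ X, ∀ y ∈ X, Γ x y ≠ 3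

theorem fire_of_mem (Γ : CoxeterMatrix V) {X : Finset V} (f : V → ℤ) {y : V} (hy : y ∈ X) :
    Γ.fire X f y = -f y := by
  simp [fire, hy]

open Classical in
theorem fire_of_notMem (Γ : CoxeterMatrix V) {X : Finset V} (f : V → ℤ) {y : V} (hy : y ∉ X) :
    Γ.fire X f y = f y + ∑ x ∈ X with Γ x y = 3, f x := by
  simp [fire, hy]

theorem IsIndep.fire_of_subset {Γ : CoxeterMatrix V} {X S : Finset V} (hX : Γ.IsIndep X)
    (hS : S ⊆ X) (f : V → ℤ) {y : V} (hy : y ∈ X) (hyS : y ∉ S) : Γ.fire S f y = f y := by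
  classical
  rw [fire_of_notMem _ _ hyS, Finset.filter_false_of_mem, Finset.sum_empty, add_zero]
  exact fun x hx => hX x (hS hx) y hy

theorem fire_fire (Γ : CoxeterMatrix V) (X : Finset V) (f : V → ℤ) :
    Γ.fire X (Γ.fire X f) = f := by
  classical
  ext y
  by_cases hy : y ∈ X
  · simp [fire_of_mem _ _ hy]
  · rw [fire_of_notMem _ _ hy, fire_of_notMem _ _ hy, add_assoc, ← Finset.sum_add_distrib,
      Finset.sum_eq_zero, add_zero]
    intro x hx
    simp [fire_of_mem _ _ (Finset.mem_filter.1 hx).1]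

theorem fire_singleton (Γ : CoxeterMatrix V) (x : V) (f : V → ℤ) (y : V) [Decidable (y = x)] :
    Γ.fire {x} f y = if y = x then -f y else if Γ x y = 3 then f y + f x else f y := by
  classical
  by_cases h : y = x
  · simp [fire, h]
  · by_cases h3 : Γ x y = 3 <;> simp [fire, h, Finset.sum_filter, h3]

/-- All labels are `2` or `3`. -/
def IsSimplyLaced (Γ : CoxeterMatrix V) : Prop :=
  ∀ x y, x ≠ y → Γ x y = 2 ∨ Γ x y = 3

/-- Firing a single vertex, as a permutation. -/
noncomputable def firePerm (Γ : CoxeterMatrix V) (x : V) : Equiv.Perm (V → ℤ) :=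
  Function.Involutive.toPerm (Γ.fire {x}) (Γ.fire_fire {x})

theorem firePerm_apply (Γ : CoxeterMatrix V) (x : V) (f : V → ℤ) :
    Γ.firePerm x f = Γ.fire {x} f := rfl

theorem firePerm_mul_self (Γ : CoxeterMatrix V) (x : V) : Γ.firePerm x * Γ.firePerm x = 1 :=
  Equiv.ext (Γ.fire_fire {x})

theorem IsSimplyLaced.isLiftable {Γ : CoxeterMatrix V} (h : Γ.IsSimplyLaced) :
    Γ.IsLiftable Γ.firePerm := by
  classical
  intro x y
  rcases eq_or_ne x y with rfl | hxy
  · simp [firePerm_mul_self]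
  rw [← altProd_comm_iff (firePerm_mul_self Γ x) (firePerm_mul_self Γ y)]
  have hs : Γ y x = Γ x y := Γ.symmetric y x
  rcases h x y hxy with h2 | h3
  · rw [h2] at hs ⊢
    ext f z
    simp only [altProd, one_mul, Equiv.Perm.mul_apply, firePerm_apply, fire_singleton, hs, h2]
    rcases eq_or_ne z x with rfl | hzx
    · simp [hxy, hs]
    rcases eq_or_ne z y with rfl | hzy
    · simp [hxy.symm, h2]
    simp [hzx, hzy, hxy, hxy.symm]
    split_ifs <;> ring
  · rw [h3] at hs ⊢
    ext f z
    simp only [altProd, one_mul, Equiv.Perm.mul_apply, firePerm_apply, fire_singleton, hs, h3]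
    rcases eq_or_ne z x with rfl | hzx
    · simp [hxy, hxy.symm, hs]
    rcases eq_or_ne z y with rfl | hzy
    · simp [hxy.symm, h3, hxy]
    simp [hzx, hzy, hxy, hxy.symm]
    split_ifs <;> ring

/-- The action of a simply laced Coxeter group on functions by the numbers game. -/
noncomputable def act (Γ : CoxeterMatrix V) (h : Γ.IsSimplyLaced) :
    Γ.Group →* Equiv.Perm (V → ℤ) :=
  Γ.toCoxeterSystem.lift ⟨Γ.firePerm, h.isLiftable⟩

theorem act_simple (Γ : CoxeterMatrix V) (h : Γ.IsSimplyLaced) (x : V) (f : V → ℤ) :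
    Γ.act h (Γ.simple x) f = Γ.fire {x} f :=
  DFunLike.congr_fun (Γ.toCoxeterSystem.lift_apply_simple h.isLiftable x) f

/-! ### Signs of coordinates, ascents and faithfulness -/

namespace IsSimplyLaced

variable {Γ : CoxeterMatrix V} {f : V → ℤ} {w : Γ.Group} {x : V}

theorem inv_simple (Γ : CoxeterMatrix V) (x : V) : (Γ.simple x)⁻¹ = Γ.simple x :=
  Γ.toCoxeterSystem.inv_simple x

/-- In `pos_of_ascent` with `p = id` only alternating products with at most two factors occur; they
turn the value at `i` into `f i`, `f i + f j` or `f j`. -/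
theorem pos_of_len_lt (h : Γ.IsSimplyLaced) (hf : ∀ x, 0 < f x)
    (hx : Γ.len w < Γ.len (w * Γ.simple x)) : 0 < Γ.act h w⁻¹ f x := by
  classical
  refine Γ.pos_of_ascent (Γ.act h) id ?_ hf hx rfl
  rintro i j hij k hk f hf _ rfl
  simp only [id] at hij hk hf ⊢
  have hi := hf _ (Or.inl rfl)
  have hj := hf _ (Or.inr rfl)
  rename_i y
  have hs : Γ j y = Γ y j := Γ.symmetric j y
  rcases h y j hij with h2 | h3
  · obtain rfl | rfl : k = 0 ∨ k = 1 := by omega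
    · simpa [altProd] using hi
    · simpa [altProd, inv_simple, act_simple, fire_singleton, hij, hs, h2] using hi
  · obtain rfl | rfl | rfl : k = 0 ∨ k = 1 ∨ k = 2 := by omega
    · simpa [altProd] using hi
    · simpa [altProd, inv_simple, act_simple, fire_singleton, hij, hs, h3] using add_pos hi hj
    · simpa [altProd, inv_simple, act_simple, fire_singleton, hij, hij.symm, hs, h3] using hj

theorem neg_of_len_lt (h : Γ.IsSimplyLaced) (hf : ∀ x, 0 < f x)
    (hx : Γ.len (w * Γ.simple x) < Γ.len w) : Γ.act h w⁻¹ f x < 0 := by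
  have := h.pos_of_len_lt hf (w := w * Γ.simple x) (x := x) (by rwa [mul_simple_cancel])
  rw [mul_inv_rev, inv_simple, map_mul, Equiv.Perm.mul_apply, act_simple,
    fire_of_mem _ _ (Finset.mem_singleton_self x)] at this
  omega

theorem len_lt_iff (h : Γ.IsSimplyLaced) (hf : ∀ x, 0 < f x) :
    Γ.len w < Γ.len (w * Γ.simple x) ↔ 0 < Γ.act h w⁻¹ f x := by
  refine ⟨h.pos_of_len_lt hf, fun hpos => ?_⟩
  by_contra hlt
  have := h.neg_of_len_lt hf (w := w) (x := x) (by
    rcases Γ.len_mul_simple w x with h | h <;> omega)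
  omega

theorem mem_ascents (h : Γ.IsSimplyLaced) (hpos : 0 < Γ.act h w⁻¹ 1 x) : x ∈ Γ.ascents w := by
  have := (h.len_lt_iff (f := 1) (fun _ => one_pos)).2 hpos
  rcases Γ.len_mul_simple w x with h | h
  · exact h
  · omega

theorem mem_descents (h : Γ.IsSimplyLaced) (hneg : Γ.act h w⁻¹ 1 x < 0) :
    x ∈ Γ.descents w := by
  rcases Γ.len_mul_simple w x with h' | h'
  · have := h.pos_of_len_lt (f := 1) (fun _ => one_pos) (w := w) (x := x) (by omega)
    omega
  · exact h'

/-- A nontrivial `w` has a descent, where every positive `f` becomes negative. Letting `f` depend on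
`x` is essential for `eq_one_of_mem_parabolic`. -/
theorem eq_one_of_pos (h : Γ.IsSimplyLaced) (hpos : ∀ x, ∃ f : V → ℤ, (∀ y, 0 < f y) ∧
    0 < Γ.act h w⁻¹ f x) : w = 1 := by
  by_contra hw
  obtain ⟨x, hx⟩ := Γ.exists_descent hw
  obtain ⟨f, hf, hfx⟩ := hpos x
  exact absurd (h.neg_of_len_lt hf hx) hfx.le.not_gt

theorem act_injective (h : Γ.IsSimplyLaced) : Function.Injective (Γ.act h) := by
  rw [injective_iff_map_eq_one]
  intro w hw
  refine h.eq_one_of_pos fun x => ⟨1, fun _ => one_pos, ?_⟩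
  rw [map_inv, hw]
  exact one_pos

/-! ### Independent sets and their longest elements -/

open Classical in
theorem fire_insert_or_erase {X S : Finset V} (hX : Γ.IsIndep X) (hS : S ⊆ X) (hx : x ∈ X)
    (f : V → ℤ) :
    Γ.fire {x} (Γ.fire S f) = Γ.fire (if x ∈ S then S.erase x else insert x S) f := by
  ext y
  by_cases hxS : x ∈ S
  · rw [if_pos hxS]
    rcases eq_or_ne y x with rfl | hyx
    · rw [fire_of_mem _ _ (Finset.mem_singleton_self y), fire_of_mem _ _ hxS, neg_neg,
        hX.fire_of_subset ((Finset.erase_subset _ _).trans hS) _ hx (Finset.notMem_erase _ _)]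
    · rw [fire_of_notMem _ _ (by simpa using hyx)]
      by_cases hyS : y ∈ S
      · have := hX x hx y (hS hyS)
        rw [fire_of_mem _ _ hyS, fire_of_mem _ _ (Finset.mem_erase.2 ⟨hyx, hyS⟩)]
        simp [Finset.sum_filter, this]
      · rw [fire_of_notMem _ _ hyS, fire_of_notMem _ _ (fun h => hyS (Finset.mem_of_mem_erase h))]
        simp only [Finset.sum_filter, Finset.sum_singleton, fire_of_mem _ _ hxS]
        rw [← Finset.add_sum_erase _ _ hxS]
        split_ifs <;> ring
  · rw [if_neg hxS]
    rcases eq_or_ne y x with rfl | hyx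
    · rw [fire_of_mem _ _ (Finset.mem_singleton_self y),
        fire_of_mem _ _ (Finset.mem_insert_self _ _), hX.fire_of_subset hS _ hx hxS]
    · rw [fire_of_notMem _ _ (by simpa using hyx)]
      by_cases hyS : y ∈ S
      · have := hX x hx y (hS hyS)
        rw [fire_of_mem _ _ hyS, fire_of_mem _ _ (Finset.mem_insert_of_mem hyS)]
        simp [Finset.sum_filter, this]
      · rw [fire_of_notMem _ _ hyS, fire_of_notMem _ _ (by simp [hyx, hyS])]
        simp only [Finset.sum_filter, Finset.sum_singleton, Finset.sum_insert hxS,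
          hX.fire_of_subset hS _ hx hxS]
        split_ifs <;> ring

/-- Firings inside an independent set are commuting involutions, so only the set of vertices fired
an odd number of times matters. By faithfulness this bounds `W_X` by the number of subsets of `X`.
-/
theorem exists_act_eq_fire (h : Γ.IsSimplyLaced) {X : Finset V} (hX : Γ.IsIndep X)
    (hw : w ∈ Γ.parabolic X) : ∃ S ⊆ X, ∀ f, Γ.act h w f = Γ.fire S f := by
  classical
  have hfire : ∀ x ∈ X, ∀ v, (∃ S ⊆ X, ∀ f, Γ.act h v f = Γ.fire S f) →
      ∃ S ⊆ X, ∀ f, Γ.act h (Γ.simple x * v) f = Γ.fire S f := by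
    rintro x hx v ⟨S, hS, hv⟩
    refine ⟨if x ∈ S then S.erase x else insert x S, ?_, fun f => ?_⟩
    · split_ifs
      · exact (Finset.erase_subset _ _).trans hS
      · exact Finset.insert_subset hx hS
    · rw [map_mul, Equiv.Perm.mul_apply, act_simple, hv, fire_insert_or_erase hX hS hx]
  induction hw using Subgroup.closure_induction_left with
  | one => exact ⟨∅, by simp, fun f => by ext y; simp [fire]⟩
  | mul_left s hs v _ ih =>
    obtain ⟨x, hx, rfl⟩ := hs
    exact hfire x hx v ih
  | inv_mul_cancel s hs v _ ih =>
    obtain ⟨x, hx, rfl⟩ := hs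
    rw [inv_simple]
    exact hfire x hx v ih

theorem isSpherical (h : Γ.IsSimplyLaced) {X : Finset V} (hX : Γ.IsIndep X) :
    Γ.IsSpherical X := by
  choose S hS hact using fun w : Γ.parabolic X => h.exists_act_eq_fire hX w.2
  refine Finite.of_injective (β := X.powerset) (fun w => ⟨S w, Finset.mem_powerset.2 (hS w)⟩) ?_
  intro v w hvw
  have hvw : S v = S w := congrArg Subtype.val hvw
  refine Subtype.ext (h.act_injective (Equiv.ext fun f => ?_))
  rw [hact, hact, hvw]

/-- A vertex of `X` left unfired would keep the value `1`, hence be an ascent of the longest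
element. -/
theorem act_longest (h : Γ.IsSimplyLaced) {X : Finset V} (hX : Γ.IsIndep X) (f : V → ℤ) :
    Γ.act h (Γ.longest X) f = Γ.fire X f := by
  obtain ⟨hmem, hmax⟩ := (h.isSpherical hX).isLongest_longest
  obtain ⟨S, hS, hact⟩ := h.exists_act_eq_fire hX hmem
  have hinv : ∀ f, Γ.act h (Γ.longest X)⁻¹ f = Γ.fire S f := by
    intro f
    rw [map_inv, Equiv.Perm.inv_eq_iff_eq, hact, fire_fire]
  suffices S = X by rw [hact, this]
  refine hS.antisymm fun x hx => ?_
  by_contra hxS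
  have hlt := (h.len_lt_iff (f := 1) (fun _ => one_pos) (w := Γ.longest X) (x := x)).2 (by
    rw [hinv, hX.fire_of_subset hS _ hx hxS]
    exact one_pos)
  exact hlt.not_ge (hmax _ (mul_mem hmem (Subgroup.subset_closure ⟨x, hx, rfl⟩)))

theorem longest_mul_self (h : Γ.IsSimplyLaced) {X : Finset V} (hX : Γ.IsIndep X) :
    Γ.longest X * Γ.longest X = 1 := by
  refine h.act_injective (Equiv.ext fun f => ?_)
  rw [map_mul, Equiv.Perm.mul_apply, h.act_longest hX, h.act_longest hX, fire_fire, map_one,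
    Equiv.Perm.one_apply]

/-- An element of `W_J` that fixes the coordinates in `J` is trivial. -/
theorem eq_one_of_mem_parabolic (h : Γ.IsSimplyLaced) {J : Set V} (hw : w ∈ Γ.parabolic J)
    (hJ : ∀ f, ∀ x ∈ J, Γ.act h w⁻¹ f x = f x) : w = 1 := by
  classical
  -- Only vertices of `J` are fired, so a perturbation vanishing on `J` is carried along unchanged.
  have hadd : ∀ v ∈ Γ.parabolic J, ∀ d : V → ℤ, (∀ x ∈ J, d x = 0) → ∀ f,
      Γ.act h v (f + d) = Γ.act h v f + d := by
    intro v hv d hd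
    induction hv using Subgroup.closure_induction with
    | mem s hs =>
      obtain ⟨x, hx, rfl⟩ := hs
      intro f
      ext y
      rw [act_simple, act_simple, Pi.add_apply, fire_singleton, fire_singleton]
      rcases eq_or_ne y x with rfl | hyx
      · simp [hd y hx]
      · simp only [if_neg hyx, Pi.add_apply, hd x hx]
        split_ifs <;> ring
    | one => simp
    | mul u v _ _ hu hv =>
      intro f
      simp only [map_mul, Equiv.Perm.mul_apply, hu, hv]
    | inv u _ hu =>
      intro f
      rw [map_inv, Equiv.Perm.inv_eq_iff_eq, hu, ← Equiv.Perm.mul_apply, mul_inv_cancel,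
        Equiv.Perm.one_apply]
  refine h.eq_one_of_pos fun z => ?_
  by_cases hz : z ∈ J
  · exact ⟨1, fun _ => one_pos, by rw [hJ _ z hz]; exact one_pos⟩
  · have hd : 0 ≤ |Γ.act h w⁻¹ 1 z| := abs_nonneg _
    -- Raising the initial value at `z` beyond the possible loss makes the final value positive.
    refine ⟨1 + Pi.single z (|Γ.act h w⁻¹ 1 z| + 1), fun y => ?_, ?_⟩
    · rcases eq_or_ne y z with rfl | hyz
      · simp only [Pi.add_apply, Pi.one_apply, Pi.single_eq_same]
        omega
      · simp [hyz]
    · rw [hadd _ (inv_mem hw), Pi.add_apply, Pi.single_eq_same]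
      · have := neg_abs_le (Γ.act h w⁻¹ 1 z)
        omega
      · intro x hx
        refine Pi.single_eq_of_ne ?_ _
        rintro rfl
        exact hz hx

end IsSimplyLaced

/-! ### Alternate firing and Chebyshev polynomials -/

/-- The result of firing `X` and `Y` alternately, `k` times in total, the last one being `Y`. -/
noncomputable def game (Γ : CoxeterMatrix V) : Finset V → Finset V → ℕ → (V → ℤ) → V → ℤ
  | _, _, 0, f => f
  | X, Y, k + 1, f => Γ.fire Y (Γ.game Y X k f)

open Classical in
/-- The matrix coefficients of the rescaled Chebyshev polynomials of the second kind, evaluated at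
the adjacency matrix of the graph on `J`; the polynomial of degree `k` has index `k + 2`. -/
noncomputable def kernel (Γ : CoxeterMatrix V) (J : Finset V) : ℕ → V → V → ℤ
  | 0, x, y => if x = y then -1 else 0
  | 1, _, _ => 0
  | k + 2, x, y => ∑ z ∈ J with Γ z y = 3, Γ.kernel J (k + 1) x z - Γ.kernel J k x y

open Classical in
theorem kernel_add_two (Γ : CoxeterMatrix V) (J : Finset V) (k : ℕ) (x y : V) :
    Γ.kernel J (k + 2) x y =
      ∑ z ∈ J with Γ z y = 3, Γ.kernel J (k + 1) x z - Γ.kernel J k x y := by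
  rw [kernel]

open Classical in
theorem kernel_two (Γ : CoxeterMatrix V) (J : Finset V) (x y : V) :
    Γ.kernel J 2 x y = if x = y then 1 else 0 := by
  by_cases h : x = y <;> simp [kernel, h]

open Classical in
theorem IsIndep.filter_union_left {Γ : CoxeterMatrix V} {X : Finset V} (hX : Γ.IsIndep X)
    (Y : Finset V) {y : V} (hy : y ∈ X) :
    {z ∈ X ∪ Y | Γ z y = 3} = {z ∈ Y | Γ z y = 3} := by
  rw [Finset.filter_union, Finset.filter_false_of_mem (s := X) fun z hz => hX z hz y hy,
    Finset.empty_union]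

-- With `U_k` at index `k + 2`, the values are `U_k + U_{k-1}` on `X` and `-(U_{k-1} + U_{k-2})` on
-- `Y`, the set fired last. The next firing exchanges the two roles and is the Chebyshev recursion.
open Classical in
theorem game_eq_sum_kernel {Γ : CoxeterMatrix V} {X Y : Finset V} (hX : Γ.IsIndep X)
    (hY : Γ.IsIndep Y) (hXY : Disjoint X Y) (f : V → ℤ) (k : ℕ) :
    (∀ y ∈ X, Γ.game X Y k f y = ∑ x ∈ X ∪ Y,
      (Γ.kernel (X ∪ Y) (k + 2) x y + Γ.kernel (X ∪ Y) (k + 1) x y) * f x) ∧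
    (∀ y ∈ Y, Γ.game X Y k f y = -∑ x ∈ X ∪ Y,
      (Γ.kernel (X ∪ Y) (k + 1) x y + Γ.kernel (X ∪ Y) k x y) * f x) := by
  induction k generalizing X Y with
  | zero =>
    refine ⟨fun y hy => ?_, fun y hy => ?_⟩
    · simp only [game, zero_add, kernel_two]
      simp [kernel, hy]
    · simp [game, kernel, hy]
  | succ k ih =>
    obtain ⟨ih1, ih2⟩ := ih hY hX hXY.symm
    rw [Finset.union_comm Y X] at ih1 ih2
    refine ⟨fun y hy => ?_, fun y hy => ?_⟩
    · rw [game, fire_of_notMem _ _ (Finset.disjoint_left.1 hXY hy), ih2 y hy,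
        Finset.sum_congr rfl fun z hz => ih1 z (Finset.mem_filter.1 hz).1, Finset.sum_comm,
        ← Finset.sum_neg_distrib, ← Finset.sum_add_distrib]
      refine Finset.sum_congr rfl fun x _ => ?_
      rw [kernel_add_two _ _ (k + 1), kernel_add_two _ _ k, hX.filter_union_left Y hy, ← Finset.sum_mul,
        Finset.sum_add_distrib]
      ring
    · rw [game, fire_of_mem _ _ hy, ih1 y hy]

theorem game_surjective (Γ : CoxeterMatrix V) (X Y : Finset V) (k : ℕ) :
    Function.Surjective (Γ.game X Y k) := by
  induction k generalizing X Y with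
  | zero => exact Function.surjective_id
  | succ k ih =>
    intro g
    obtain ⟨f, hf⟩ := ih Y X (Γ.fire Y g)
    exact ⟨f, by rw [game, hf, fire_fire]⟩

-- Nonnegative coefficients give a nonnegative value. If it were zero for some strictly positive
-- `f`, all coefficients would vanish and the value at `y` would be zero for every initial function,
-- contrary to `game_surjective`.
open Classical in
theorem game_pos {Γ : CoxeterMatrix V} {X Y : Finset V} (hX : Γ.IsIndep X)
    (hY : Γ.IsIndep Y) (hXY : Disjoint X Y) {k : ℕ}
    (hK : ∀ l ≤ k, ∀ x ∈ X ∪ Y, ∀ y ∈ X ∪ Y, 0 ≤ Γ.kernel (X ∪ Y) (l + 2) x y)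
    {f : V → ℤ} (hf : ∀ x ∈ X ∪ Y, 0 < f x) {y : V} (hy : y ∈ X) : 0 < Γ.game X Y k f y := by
  have hyJ : y ∈ X ∪ Y := Finset.mem_union_left _ hy
  have hnn : ∀ x ∈ X ∪ Y,
      0 ≤ Γ.kernel (X ∪ Y) (k + 2) x y + Γ.kernel (X ∪ Y) (k + 1) x y := by
    intro x hx
    refine add_nonneg (hK k le_rfl x hx y hyJ) ?_
    cases k with
    | zero => simp [kernel]
    | succ k => exact hK k (Nat.le_succ k) x hx y hyJ
  rw [(game_eq_sum_kernel hX hY hXY f k).1 y hy]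
  refine lt_of_le_of_ne
    (Finset.sum_nonneg fun x hx => mul_nonneg (hnn x hx) (hf x hx).le) fun h0 => ?_
  obtain ⟨g, hg⟩ := Γ.game_surjective X Y k 1
  have h1 := (game_eq_sum_kernel hX hY hXY g k).1 y hy
  rw [hg, Finset.sum_eq_zero] at h1
  · exact one_ne_zero h1
  · intro x hx
    have := (Finset.sum_eq_zero_iff_of_nonneg
      fun x hx => mul_nonneg (hnn x hx) (hf x hx).le).1 h0.symm x hx
    rw [(mul_eq_zero.1 this).resolve_right (hf x hx).ne', zero_mul]

-- `U_{m-1} = 0` forces `U_m = -U_{m-2}`, so the formulas for the set fired last and for the other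
-- one coincide.
open Classical in
theorem game_comm {Γ : CoxeterMatrix V} {X Y : Finset V} (hX : Γ.IsIndep X)
    (hY : Γ.IsIndep Y) (hXY : Disjoint X Y) {m : ℕ}
    (hK : ∀ x ∈ X ∪ Y, ∀ y ∈ X ∪ Y, Γ.kernel (X ∪ Y) (m + 1) x y = 0) (f : V → ℤ) {y : V}
    (hy : y ∈ X ∪ Y) : Γ.game X Y m f y = Γ.game Y X m f y := by
  have h1 : ∀ x ∈ X ∪ Y, ∀ y ∈ X ∪ Y,
      Γ.kernel (X ∪ Y) (m + 2) x y = -Γ.kernel (X ∪ Y) m x y := by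
    intro x hx y hy
    rw [kernel_add_two, Finset.sum_eq_zero, zero_sub]
    exact fun z hz => hK x hx z (Finset.mem_filter.1 hz).1
  have h2 : ∀ y ∈ X ∪ Y, ∑ x ∈ X ∪ Y,
      (Γ.kernel (X ∪ Y) (m + 2) x y + Γ.kernel (X ∪ Y) (m + 1) x y) * f x =
      -∑ x ∈ X ∪ Y, (Γ.kernel (X ∪ Y) (m + 1) x y + Γ.kernel (X ∪ Y) m x y) * f x := by
    intro y hy
    rw [← Finset.sum_neg_distrib]
    refine Finset.sum_congr rfl fun x hx => ?_
    rw [h1 x hx y hy, hK x hx y hy]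
    ring
  obtain ⟨a1, a2⟩ := game_eq_sum_kernel hX hY hXY f m
  obtain ⟨b1, b2⟩ := game_eq_sum_kernel hY hX hXY.symm f m
  rw [Finset.union_comm Y X] at b1 b2
  rcases Finset.mem_union.1 hy with h | h
  · rw [a1 y h, b2 y h, h2 y hy]
  · rw [a2 y h, b1 y h, h2 y hy]

/-! ### Kernels on bipartite models -/

/-- The graph on `J` is a disjoint union of copies of the bipartite double of the graph with
vertex set `R` and edges `E`, or of one half of it: a vertex is determined by its side, its copy and
its position in `R`. -/
structure IsBipartiteModel (Γ : CoxeterMatrix V) (J : Finset V) (side : V → Prop) (c P : V → ℕ)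
    (R : Finset ℕ) (E : ℕ → ℕ → Prop) : Prop where
  mem : ∀ x ∈ J, P x ∈ R
  inj : ∀ x ∈ J, ∀ y ∈ J, (side x ↔ side y) → c x = c y → P x = P y → x = y
  adj : ∀ x ∈ J, ∀ y ∈ J,
    (Γ x y = 3 ↔ ¬(side x ↔ side y) ∧ c x = c y ∧ E (P x) (P y))
  ex : ∀ y ∈ J, ∀ b ∈ R, E b (P y) → ∃ x ∈ J, ¬(side x ↔ side y) ∧ c x = c y ∧ P x = b

namespace IsBipartiteModel

variable {Γ : CoxeterMatrix V} {J : Finset V} {side : V → Prop} {c P : V → ℕ}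
  {R : Finset ℕ} {E : ℕ → ℕ → Prop}

open Classical in
theorem sum_adj [∀ d b, Decidable (E d b)] (h : Γ.IsBipartiteModel J side c P R E) {y : V} (hy : y ∈ J) (g : ℕ → ℤ) :
    ∑ z ∈ J with Γ z y = 3, g (P z) = ∑ b ∈ R with E b (P y), g b := by
  refine Finset.sum_nbij P ?_ ?_ ?_ fun _ _ => rfl
  · intro z hz
    obtain ⟨hzJ, hz⟩ := Finset.mem_filter.1 hz
    exact Finset.mem_filter.2 ⟨h.mem z hzJ, ((h.adj z hzJ y hy).1 hz).2.2⟩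
  · intro z hz w hw hzw
    obtain ⟨hzJ, hz⟩ := Finset.mem_filter.1 hz
    obtain ⟨hwJ, hw⟩ := Finset.mem_filter.1 hw
    have hz := (h.adj z hzJ y hy).1 hz
    have hw := (h.adj w hwJ y hy).1 hw
    exact h.inj z hzJ w hwJ (by tauto) (hz.2.1.trans hw.2.1.symm) hzw
  · intro b hb
    obtain ⟨hbR, hb⟩ := Finset.mem_filter.1 hb
    obtain ⟨x, hxJ, hx1, hx2, rfl⟩ := h.ex y hy b hbR hb
    exact ⟨x, Finset.mem_filter.2 ⟨hxJ, (h.adj x hxJ y hy).2 ⟨hx1, hx2, hb⟩⟩, rfl⟩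

open Classical in
/-- If `n` satisfies the Chebyshev recursion on `R`, then it describes the kernel on `J`. -/
theorem kernel_eq [∀ d b, Decidable (E d b)] (h : Γ.IsBipartiteModel J side c P R E)
    (n : ℕ → ℕ → ℕ → ℤ) (B : ℕ → Prop)
    (hB : ∀ k, B (k + 1) → B k)
    (n_zero : ∀ a ∈ R, ∀ b ∈ R, n 0 a b = 0)
    (n_one : ∀ a ∈ R, ∀ b ∈ R, n 1 a b = if a = b then 1 else 0)
    (n_add_two : ∀ k, B (k + 2) → ∀ a ∈ R, ∀ b ∈ R,
      n (k + 2) a b = ∑ d ∈ R with E d b, n (k + 1) a d - n k a b)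
    {k : ℕ} (hk : B k) {x y : V} (hx : x ∈ J) (hy : y ∈ J) :
    Γ.kernel J (k + 1) x y =
      if c x = c y ∧ ((side x ↔ side y) ↔ Odd k) then n k (P x) (P y) else 0 := by
  induction k using Nat.twoStepInduction generalizing y with
  | zero => simp [kernel, n_zero _ (h.mem x hx) _ (h.mem y hy)]
  | one =>
    rw [kernel_two, n_one _ (h.mem x hx) _ (h.mem y hy)]
    by_cases hxy : x = y
    · simp [hxy]
    · rw [if_neg hxy, ← ite_and, if_neg]
      rintro ⟨⟨h1, h2⟩, h3⟩
      exact hxy (h.inj x hx y hy (h2.2 odd_one) h1 h3)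
  | more k ih0 ih1 =>
    have hB1 : B (k + 1) := hB _ hk
    have hB0 : B k := hB _ hB1
    rw [kernel_add_two, ih0 hB0 hy]
    -- An edge keeps the copy and changes the side, so the parity condition for `z` at `k + 1` is
    -- the one for `y` at `k`.
    have hsum : ∑ z ∈ J with Γ z y = 3, Γ.kernel J (k + 1 + 1) x z =
        ∑ z ∈ J with Γ z y = 3,
          if c x = c y ∧ ((side x ↔ side y) ↔ Odd k) then n (k + 1) (P x) (P z) else 0 := by
      refine Finset.sum_congr rfl fun z hz => ?_
      obtain ⟨hzJ, hz⟩ := Finset.mem_filter.1 hz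
      obtain ⟨h1, h2, -⟩ := (h.adj z hzJ y hy).1 hz
      rw [ih1 hB1 hzJ, h2]
      refine if_congr (and_congr_right fun _ => ?_) rfl rfl
      rw [Nat.odd_add_one]
      tauto
    have hodd : Odd (k + 2) ↔ Odd k := by
      rw [Nat.odd_add_one, Nat.odd_add_one, not_not]
    simp only [hsum, hodd]
    by_cases hc : c x = c y ∧ ((side x ↔ side y) ↔ Odd k)
    · simp only [if_pos hc]
      rw [h.sum_adj hy (fun d => n (k + 1) (P x) d),
        n_add_two k hk _ (h.mem x hx) _ (h.mem y hy)]
    · simp [if_neg hc]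

end IsBipartiteModel

/-! ### Chebyshev polynomials of the path and of the 4-cycle -/

namespace IsBipartiteModel

variable {Γ : CoxeterMatrix V} {J : Finset V} {side : V → Prop} {c P : V → ℕ}

/-- The structure constants of the fusion ring of `SU(2)` at level `m - 2`: the entries of the
Chebyshev polynomial of degree `k - 1` in the adjacency matrix of the path on `1, …, m - 1`. -/
def fusionCoeff (m k a b : ℕ) : ℤ :=
  if (k + a + b) % 2 = 1 ∧ a < k + b ∧ b < k + a ∧ k < a + b ∧ k + a + b < 2 * m then 1 else 0

theorem fusionCoeff_nonneg (m k a b : ℕ) : 0 ≤ fusionCoeff m k a b := by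
  unfold fusionCoeff
  split_ifs <;> simp

theorem fusionCoeff_self {m a b : ℕ} : fusionCoeff m m a b = 0 := by
  unfold fusionCoeff
  rw [if_neg]
  omega

/-- Truncated Clebsch–Gordan rule: tensoring with the two-dimensional representation may be
performed on the factor `k + 1` or on the factor `b`. -/
theorem fusionCoeff_add_two {m k a b : ℕ} (hk : k + 2 ≤ m) (ha : 0 < a) (ha' : a < m)
    (hb : 0 < b) (hb' : b < m) :
    fusionCoeff m (k + 2) a b + fusionCoeff m k a b =
      fusionCoeff m (k + 1) a (b - 1) + fusionCoeff m (k + 1) a (b + 1) := by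
  unfold fusionCoeff
  split_ifs <;> first | rfl | (exfalso; omega)

/-- The indices `0` and `m` lie off the path, but the coefficients vanish there. -/
theorem sum_fusionCoeff {m k a b : ℕ} (hb : 0 < b) :
    ∑ d ∈ Finset.Ioo 0 m with d = b + 1 ∨ b = d + 1, fusionCoeff m k a d =
      fusionCoeff m k a (b - 1) + fusionCoeff m k a (b + 1) := by
  rw [← Finset.sum_pair (by omega : b - 1 ≠ b + 1)]
  refine Finset.sum_subset (fun d hd => ?_) fun d hd hd' => ?_
  · simp only [Finset.mem_filter, Finset.mem_Ioo, Finset.mem_insert, Finset.mem_singleton] at hd ⊢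
    omega
  · simp only [Finset.mem_filter, Finset.mem_Ioo, Finset.mem_insert,
      Finset.mem_singleton] at hd hd'
    unfold fusionCoeff
    rw [if_neg]
    omega

open Classical in
theorem kernel_eq_fusionCoeff {m : ℕ}
    (h : Γ.IsBipartiteModel J side c P (Finset.Ioo 0 m) fun d b => d = b + 1 ∨ b = d + 1)
    {k : ℕ} (hk : k ≤ m) {x y : V} (hx : x ∈ J) (hy : y ∈ J) :
    Γ.kernel J (k + 1) x y =
      if c x = c y ∧ ((side x ↔ side y) ↔ Odd k) then fusionCoeff m k (P x) (P y) else 0 := by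
  -- The bound `k ≤ m` is needed: `U_m = -U_{m-2}` has negative entries, while fusion coefficients
  -- never do.
  refine h.kernel_eq (fusionCoeff m) (· ≤ m) (fun k hk => by omega) ?_ ?_ ?_ hk hx hy
  · intro a _ b _
    unfold fusionCoeff
    rw [if_neg]
    omega
  · intro a ha b hb
    rw [Finset.mem_Ioo] at ha hb
    unfold fusionCoeff
    refine if_congr ?_ rfl rfl
    omega
  · intro k hk a ha b hb
    rw [Finset.mem_Ioo] at ha hb
    rw [sum_fusionCoeff hb.1, ← fusionCoeff_add_two hk ha.1 ha.2 hb.1 hb.2, add_sub_cancel_right]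

theorem kernel_nonneg_of_path {m : ℕ}
    (h : Γ.IsBipartiteModel J side c P (Finset.Ioo 0 m) fun d b => d = b + 1 ∨ b = d + 1)
    {k : ℕ} (hk : k ≤ m) {x y : V} (hx : x ∈ J) (hy : y ∈ J) : 0 ≤ Γ.kernel J (k + 1) x y := by
  rw [h.kernel_eq_fusionCoeff hk hx hy]
  split_ifs
  · exact fusionCoeff_nonneg _ _ _ _
  · exact le_rfl

theorem kernel_eq_zero_of_path {m : ℕ}
    (h : Γ.IsBipartiteModel J side c P (Finset.Ioo 0 m) fun d b => d = b + 1 ∨ b = d + 1)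
    {x y : V} (hx : x ∈ J) (hy : y ∈ J) : Γ.kernel J (m + 1) x y = 0 := by
  rw [h.kernel_eq_fusionCoeff le_rfl hx hy, fusionCoeff_self, ite_self]

/-- The entries of the Chebyshev polynomial of degree `k - 1` in the adjacency matrix of a cycle of
length four. -/
def squareCoeff (k a b : ℕ) : ℤ :=
  if k % 2 = 1 ∧ (a = b ↔ k % 4 = 1) then (k / 2 : ℕ) + 1 else (k / 2 : ℕ)

/-- The 4-cycle is the bipartite double of two vertices with all edges and loops. The all-ones
matrix has eigenvalues `2` and `0`, where `U_{k-1}` is `k` and `ε ∈ {0, 1, -1}`; hence the entries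
`(k ± ε) / 2`. -/
theorem kernel_nonneg_of_square
    (h : Γ.IsBipartiteModel J side c P (Finset.range 2) fun _ _ => True)
    (k : ℕ) {x y : V} (hx : x ∈ J) (hy : y ∈ J) : 0 ≤ Γ.kernel J (k + 1) x y := by
  classical
  rw [h.kernel_eq squareCoeff (fun _ => True) (fun _ _ => trivial) ?_ ?_ ?_ trivial hx hy]
  · split_ifs
    · unfold squareCoeff
      split_ifs <;> omega
    · exact le_rfl
  · intro a _ b _
    simp [squareCoeff]
  · intro a _ b _
    simp [squareCoeff]
  · intro k _ a ha b hb
    rw [Finset.mem_range] at ha hb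
    simp only [Finset.filter_true, Finset.sum_range_succ, Finset.sum_range_zero, squareCoeff]
    split_ifs <;> omega

end IsBipartiteModel

/-! ### Bursts and their rank-two subgraphs -/

namespace IsBurst

variable {Γ : CoxeterMatrix I} {hΓ : Γ.labels.Finite} {N : ℕ} {Γ' : CoxeterMatrix V} {p : V → I}

theorem isSimplyLaced (h : Γ.IsBurst hΓ N Γ' p) : Γ'.IsSimplyLaced := by
  intro x y hxy
  by_cases hp : p x = p y
  · exact Or.inl (h.within x y hxy hp)
  · obtain ⟨e, f, hef⟩ := h.between _ _ hp
    have := hef ⟨x, rfl⟩ ⟨y, rfl⟩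
    simp only at this
    rw [this]
    split_ifs
    · exact Or.inr rfl
    · exact Or.inl rfl

theorem nonempty_fiber (h : Γ.IsBurst hΓ N Γ' p) (i : I) : (burstFiber p i).Nonempty := by
  have := Nat.card_pos_iff.1 ((h.card i).symm ▸ h.pos)
  exact Set.nonempty_coe_sort.1 this.1

theorem finite_fiber (h : Γ.IsBurst hΓ N Γ' p) (i : I) : (burstFiber p i).Finite :=
  Nat.finite_of_card_ne_zero ((h.card i).symm ▸ h.pos.ne')

/-- The set `T(i)` as a finset. -/
noncomputable def fiber (h : Γ.IsBurst hΓ N Γ' p) (i : I) : Finset V :=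
  (h.finite_fiber i).toFinset

theorem mem_fiber (h : Γ.IsBurst hΓ N Γ' p) {i : I} {x : V} : x ∈ h.fiber i ↔ p x = i := by
  simp [fiber, burstFiber]

theorem coe_fiber (h : Γ.IsBurst hΓ N Γ' p) (i : I) :
    (h.fiber i : Set V) = burstFiber p i := by
  simp [fiber]

theorem isIndep_fiber (h : Γ.IsBurst hΓ N Γ' p) (i : I) : Γ'.IsIndep (h.fiber i) := by
  intro x hx y hy
  rw [mem_fiber] at hx hy
  rcases eq_or_ne x y with rfl | hxy
  · simp
  · simp [h.within x y hxy (hx.trans hy.symm)]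

theorem disjoint_fiber (h : Γ.IsBurst hΓ N Γ' p) {i j : I} (hij : i ≠ j) :
    Disjoint (h.fiber i) (h.fiber j) := by
  rw [Finset.disjoint_left]
  intro x hx hy
  rw [mem_fiber] at hx hy
  exact hij (hx.symm.trans hy)

open Classical in
theorem mem_union_fiber (h : Γ.IsBurst hΓ N Γ' p) {i j : I} {x : V} :
    x ∈ h.fiber i ∪ h.fiber j ↔ p x = i ∨ p x = j := by
  rw [Finset.mem_union, mem_fiber, mem_fiber]

/-- Coordinates `(copy, index)` on `T(i) ∪ T(j)`. -/
theorem exists_coords (h : Γ.IsBurst hΓ N Γ' p) {i j : I} (hij : i ≠ j) :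
    ∃ c d : V → ℕ,
      (∀ x, p x = i ∨ p x = j → d x < burstDelta (Γ i j)) ∧
      (∀ x y, p x = i ∨ p x = j → p x = p y → c x = c y → d x = d y → x = y) ∧
      (∀ x y, p x = i → p y = j →
        (Γ' x y = 3 ↔ c x = c y ∧ burstBlock (Γ i j) (d x) (d y))) ∧
      ∀ y l b, p y = i ∨ p y = j → l = i ∨ l = j → b < burstDelta (Γ i j) →
        ∃ x, p x = l ∧ c x = c y ∧ d x = b := by
  classical
  obtain ⟨e, f, hef⟩ := h.between i j hij
  let g : V → ℕ × ℕ := fun x =>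
    if hx : p x = i then ((e ⟨x, hx⟩).1, (e ⟨x, hx⟩).2)
    else if hx : p x = j then ((f ⟨x, hx⟩).1, (f ⟨x, hx⟩).2) else 0
  have gi : ∀ x (hx : p x = i), g x = (((e ⟨x, hx⟩).1 : ℕ), ((e ⟨x, hx⟩).2 : ℕ)) :=
    fun x hx => dif_pos hx
  have gj : ∀ x (hx : p x = j), g x = (((f ⟨x, hx⟩).1 : ℕ), ((f ⟨x, hx⟩).2 : ℕ)) :=
    fun x hx => by
      have : p x ≠ i := fun h => hij (h.symm.trans hx)
      simp only [g, dif_neg this, dif_pos hx]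
  refine ⟨fun x => (g x).1, fun x => (g x).2, ?_, ?_, ?_, ?_⟩
  · rintro x (hx | hx)
    · simp only [gi x hx]
      exact Fin.is_lt _
    · simp only [gj x hx]
      exact Fin.is_lt _
  · rintro x y (hx | hx) hxy h1 h2
    · simp only [gi x hx, gi y (hxy ▸ hx)] at h1 h2
      exact congrArg Subtype.val (e.injective (Prod.ext (Fin.ext h1) (Fin.ext h2)))
    · simp only [gj x hx, gj y (hxy ▸ hx)] at h1 h2
      exact congrArg Subtype.val (f.injective (Prod.ext (Fin.ext h1) (Fin.ext h2)))
  · intro x y hx hy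
    have := hef ⟨x, hx⟩ ⟨y, hy⟩
    simp only at this
    rw [this]
    simp only [gi x hx, gj y hy, Fin.ext_iff]
    split_ifs with hc
    · simp [hc]
    · simp [hc]
  · intro y l b hy hl hb
    obtain ⟨a, ha⟩ : ∃ a : Fin (N / burstDelta (Γ i j)), (g y).1 = a := by
      rcases hy with hy | hy
      · exact ⟨_, by rw [gi y hy]⟩
      · exact ⟨_, by rw [gj y hy]⟩
    rcases hl with rfl | rfl
    · obtain ⟨x, hx⟩ := e.surjective (a, ⟨b, hb⟩)
      exact ⟨x, x.2, by simp [gi x x.2, hx, ha], by simp [gi x x.2, hx]⟩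
    · obtain ⟨x, hx⟩ := f.surjective (a, ⟨b, hb⟩)
      exact ⟨x, x.2, by simp [gj x x.2, hx, ha], by simp [gj x x.2, hx]⟩

-- `u` and `v` place the vertices `•` and `∘` of a block in `R`, which reduces a model to arithmetic
-- on one block.
open Classical in
theorem exists_model (h : Γ.IsBurst hΓ N Γ' p) {i j : I} (hij : i ≠ j)
    {R : Finset ℕ} {E : ℕ → ℕ → Prop} (u v : ℕ → ℕ) (hu : u.Injective) (hv : v.Injective)
    (huR : ∀ k < burstDelta (Γ i j), u k ∈ R) (hvR : ∀ k < burstDelta (Γ i j), v k ∈ R)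
    (hE : ∀ a b, E a b ↔ E b a)
    (hB : ∀ k < burstDelta (Γ i j), ∀ l < burstDelta (Γ i j),
      (burstBlock (Γ i j) k l ↔ E (u k) (v l)))
    (hsu : ∀ b ∈ R, ∀ l < burstDelta (Γ i j), E b (v l) → ∃ k < burstDelta (Γ i j), u k = b)
    (hsv : ∀ b ∈ R, ∀ k < burstDelta (Γ i j), E b (u k) → ∃ l < burstDelta (Γ i j), v l = b) :
    ∃ c P : V → ℕ,
      Γ'.IsBipartiteModel (h.fiber i ∪ h.fiber j) (fun x => p x = i) c P R E := by
  obtain ⟨c, d, hlt, hinj, hadj, hex⟩ := h.exists_coords hij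
  have hji : ∀ {x}, p x = j → p x ≠ i := fun h h' => hij (h'.symm.trans h)
  let P : V → ℕ := fun x => if p x = i then u (d x) else v (d x)
  have Pi : ∀ x, p x = i → P x = u (d x) := fun x hx => if_pos hx
  have Pj : ∀ x, p x = j → P x = v (d x) := fun x hx => if_neg (hji hx)
  refine ⟨c, P, ?_, ?_, ?_, ?_⟩
  · intro x hx
    rw [mem_union_fiber] at hx
    rcases hx with hx' | hx'
    · rw [Pi x hx']
      exact huR _ (hlt x (.inl hx'))
    · rw [Pj x hx']
      exact hvR _ (hlt x (.inr hx'))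
  · intro x hx y hy hs hc hP
    rw [mem_union_fiber] at hx hy
    rcases hx with hx' | hx'
    · have hy' := hs.1 hx'
      rw [Pi x hx', Pi y hy'] at hP
      exact hinj x y (.inl hx') (hx'.trans hy'.symm) hc (hu hP)
    · have hy' := hy.resolve_left fun hy => hji hx' (hs.2 hy)
      rw [Pj x hx', Pj y hy'] at hP
      exact hinj x y (.inr hx') (hx'.trans hy'.symm) hc (hv hP)
  · intro x hx y hy
    have hxd := hlt x (h.mem_union_fiber.1 hx)
    have hyd := hlt y (h.mem_union_fiber.1 hy)
    rw [mem_union_fiber] at hx hy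
    rcases hx with hx' | hx' <;> rcases hy with hy' | hy'
    · simp [hx', hy', h.isIndep_fiber i x (h.mem_fiber.2 hx') y (h.mem_fiber.2 hy')]
    · rw [hadj x y hx' hy', hB _ hxd _ hyd, Pi x hx', Pj y hy']
      simp [hx', hji hy']
    · rw [Γ'.symmetric, hadj y x hy' hx', hB _ hyd _ hxd, Pi y hy', Pj x hx', hE,
        eq_comm (a := c y)]
      simp [hji hx', hy']
    · simp [hji hx', hji hy', h.isIndep_fiber j x (h.mem_fiber.2 hx') y (h.mem_fiber.2 hy')]
  · intro y hy b hb hEb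
    have hyd := hlt y (h.mem_union_fiber.1 hy)
    rw [mem_union_fiber] at hy
    rcases hy with hy' | hy'
    · rw [Pi y hy'] at hEb
      obtain ⟨l, hl, rfl⟩ := hsv b hb _ hyd hEb
      obtain ⟨x, hx, hc, rfl⟩ := hex y j l (.inl hy') (.inr rfl) hl
      exact ⟨x, h.mem_union_fiber.2 (.inr hx), by simp [hji hx, hy'], hc, Pj x hx⟩
    · rw [Pj y hy'] at hEb
      obtain ⟨l, hl, rfl⟩ := hsu b hb _ hyd hEb
      obtain ⟨x, hx, hc, rfl⟩ := hex y i l (.inr hy') (.inl rfl) hl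
      exact ⟨x, h.mem_union_fiber.2 (.inl hx), by simp [hji hy', hx], hc, Pi x hx⟩

-- For even `m` both sides occupy all positions `1, …, m - 1` and a block is two paths; for odd `m`,
-- `•` takes the odd and `∘` the even positions of a single path.
open Classical in
theorem exists_path_model (h : Γ.IsBurst hΓ N Γ' p) {i j : I} (hij : i ≠ j) (h0 : Γ i j ≠ 0) :
    ∃ c P : V → ℕ, Γ'.IsBipartiteModel (h.fiber i ∪ h.fiber j) (fun x => p x = i) c P
      (Finset.Ioo 0 (Γ i j)) fun d b => d = b + 1 ∨ b = d + 1 := by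
  have h1 := Γ.off_diagonal i j hij
  rcases Nat.even_or_odd (Γ i j) with he | ho
  · have hδ : burstDelta (Γ i j) = Γ i j - 1 := by simp [burstDelta, h0, he]
    refine h.exists_model hij (· + 1) (· + 1) (add_left_injective 1) (add_left_injective 1)
      ?_ ?_ ?_ ?_ ?_ ?_
    · intro k hk
      rw [Finset.mem_Ioo]
      omega
    · intro k hk
      rw [Finset.mem_Ioo]
      omega
    · intro a b
      omega
    · intro k _ l _
      simp only [burstBlock, if_neg h0, if_pos he]
      omega
    · intro b hb l hl hbl
      rw [Finset.mem_Ioo] at hb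
      exact ⟨b - 1, by omega, by omega⟩
    · intro b hb l hl hbl
      rw [Finset.mem_Ioo] at hb
      exact ⟨b - 1, by omega, by omega⟩
  · have hne : ¬Even (Γ i j) := Nat.not_even_iff_odd.2 ho
    have hδ : burstDelta (Γ i j) = (Γ i j - 1) / 2 := by simp [burstDelta, h0, hne]
    have hmod := Nat.odd_iff.1 ho
    refine h.exists_model hij (fun k => 2 * k + 1) (fun k => 2 * k + 2)
      (fun a b hab => ?_) (fun a b hab => ?_) ?_ ?_ ?_ ?_ ?_ ?_
    · simp only at hab
      omega
    · simp only at hab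
      omega
    · intro k hk
      rw [Finset.mem_Ioo]
      omega
    · intro k hk
      rw [Finset.mem_Ioo]
      omega
    · intro a b
      omega
    · intro k _ l _
      simp only [burstBlock, if_neg h0, if_neg hne]
      omega
    · intro b hb l hl hbl
      rw [Finset.mem_Ioo] at hb
      exact ⟨b / 2, by omega, by omega⟩
    · intro b hb l hl hbl
      rw [Finset.mem_Ioo] at hb
      exact ⟨b / 2 - 1, by omega, by omega⟩

open Classical in
theorem exists_square_model (h : Γ.IsBurst hΓ N Γ' p) {i j : I} (hij : i ≠ j) (h0 : Γ i j = 0) :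
    ∃ c P : V → ℕ, Γ'.IsBipartiteModel (h.fiber i ∪ h.fiber j) (fun x => p x = i) c P
      (Finset.range 2) fun _ _ => True := by
  have hδ : burstDelta (Γ i j) = 2 := by simp [burstDelta, h0]
  refine h.exists_model hij id id Function.injective_id Function.injective_id ?_ ?_ ?_ ?_ ?_ ?_
  · simp [hδ]
  · simp [hδ]
  · simp
  · simp [burstBlock, h0]
  · intro b hb _ _ _
    exact ⟨b, hδ ▸ Finset.mem_range.1 hb, rfl⟩
  · intro b hb _ _ _
    exact ⟨b, hδ ▸ Finset.mem_range.1 hb, rfl⟩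

open Classical in
theorem kernel_nonneg (h : Γ.IsBurst hΓ N Γ' p) {i j : I} (hij : i ≠ j) {k : ℕ}
    (hk : Γ i j = 0 ∨ k < Γ i j) {x y : V} (hx : x ∈ h.fiber i ∪ h.fiber j)
    (hy : y ∈ h.fiber i ∪ h.fiber j) : 0 ≤ Γ'.kernel (h.fiber i ∪ h.fiber j) (k + 2) x y := by
  by_cases h0 : Γ i j = 0
  · obtain ⟨c, P, hm⟩ := h.exists_square_model hij h0
    exact hm.kernel_nonneg_of_square (k + 1) hx hy
  · obtain ⟨c, P, hm⟩ := h.exists_path_model hij h0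
    exact hm.kernel_nonneg_of_path (k := k + 1) (hk.resolve_left h0) hx hy

/-! ### The homomorphism between the Coxeter groups -/

/-- The longest element of `W_{T(i)}`. -/
noncomputable def rep (_ : Γ.IsBurst hΓ N Γ' p) (i : I) : Γ'.Group :=
  Γ'.longest (burstFiber p i)

theorem act_rep (h : Γ.IsBurst hΓ N Γ' p) (i : I) (f : V → ℤ) :
    Γ'.act h.isSimplyLaced (h.rep i) f = Γ'.fire (h.fiber i) f := by
  rw [rep, ← h.coe_fiber]
  exact h.isSimplyLaced.act_longest (h.isIndep_fiber i) f

theorem rep_mul_self (h : Γ.IsBurst hΓ N Γ' p) (i : I) : h.rep i * h.rep i = 1 := by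
  rw [rep, ← h.coe_fiber]
  exact h.isSimplyLaced.longest_mul_self (h.isIndep_fiber i)

theorem inv_rep (h : Γ.IsBurst hΓ N Γ' p) (i : I) : (h.rep i)⁻¹ = h.rep i :=
  inv_eq_of_mul_eq_one_left (h.rep_mul_self i)

theorem isSpherical_fiber (h : Γ.IsBurst hΓ N Γ' p) (i : I) :
    Γ'.IsSpherical (burstFiber p i) := by
  rw [← h.coe_fiber]
  exact h.isSimplyLaced.isSpherical (h.isIndep_fiber i)

theorem act_altProd_rep (h : Γ.IsBurst hΓ N Γ' p) (i j : I) (k : ℕ) (f : V → ℤ) :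
    Γ'.act h.isSimplyLaced (altProd (h.rep i) (h.rep j) k)⁻¹ f =
      Γ'.game (h.fiber i) (h.fiber j) k f := by
  induction k generalizing i j with
  | zero => simp [altProd, game]
  | succ k ih =>
    rw [altProd, mul_inv_rev, inv_rep, map_mul, Equiv.Perm.mul_apply, ih, act_rep, game]

theorem act_altProd_rep_pos (h : Γ.IsBurst hΓ N Γ' p) {i j : I} (hij : i ≠ j) {k : ℕ}
    (hk : Γ i j = 0 ∨ k < Γ i j) {f : V → ℤ} (hf : ∀ y, p y = i ∨ p y = j → 0 < f y) {x : V}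
    (hx : p x = i) : 0 < Γ'.act h.isSimplyLaced (altProd (h.rep i) (h.rep j) k)⁻¹ f x := by
  rw [act_altProd_rep]
  refine game_pos (h.isIndep_fiber i) (h.isIndep_fiber j) (h.disjoint_fiber hij) ?_ ?_
    (h.mem_fiber.2 hx)
  · intro l hl x hx y hy
    exact h.kernel_nonneg hij (hk.imp_right (hl.trans_lt ·)) hx hy
  · intro y hy
    exact hf y (h.mem_union_fiber.1 hy)

theorem rep_mem_parabolic (h : Γ.IsBurst hΓ N Γ' p) (i : I) {J : Set V}
    (hJ : burstFiber p i ⊆ J) : h.rep i ∈ Γ'.parabolic J :=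
  Subgroup.closure_mono (Set.image_mono hJ) (h.isSpherical_fiber i).isLongest_longest.1

theorem altProd_mem {G : Type*} [Group G] {H : Subgroup G} {a b : G} (ha : a ∈ H) (hb : b ∈ H)
    (k : ℕ) : altProd a b k ∈ H := by
  induction k generalizing a b with
  | zero => exact one_mem H
  | succ k ih => exact mul_mem (ih hb ha) hb

/-- `game_comm` compares only the coordinates in `T(i) ∪ T(j)`; this suffices by
`eq_one_of_mem_parabolic`. -/
theorem altProd_rep_comm (h : Γ.IsBurst hΓ N Γ' p) {i j : I} (hij : i ≠ j) (h0 : Γ i j ≠ 0) :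
    altProd (h.rep i) (h.rep j) (Γ i j) = altProd (h.rep j) (h.rep i) (Γ i j) := by
  classical
  have hi := h.rep_mem_parabolic i (Set.subset_union_left (t := burstFiber p j))
  have hj := h.rep_mem_parabolic j (Set.subset_union_right (s := burstFiber p i))
  rw [← inv_mul_eq_one]
  refine h.isSimplyLaced.eq_one_of_mem_parabolic
    (mul_mem (inv_mem (altProd_mem hi hj _)) (altProd_mem hj hi _)) fun f x hx => ?_
  obtain ⟨c, P, hm⟩ := h.exists_path_model hij h0
  rw [mul_inv_rev, inv_inv, map_mul, Equiv.Perm.mul_apply, act_altProd_rep,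
    ← game_comm (h.isIndep_fiber i) (h.isIndep_fiber j) (h.disjoint_fiber hij)
      (fun x hx y hy => hm.kernel_eq_zero_of_path hx hy) _ (h.mem_union_fiber.2 hx),
    ← act_altProd_rep, ← Equiv.Perm.mul_apply, ← map_mul, inv_mul_cancel, map_one,
    Equiv.Perm.one_apply]

theorem isLiftable_rep (h : Γ.IsBurst hΓ N Γ' p) : Γ.IsLiftable h.rep := by
  intro i j
  rcases eq_or_ne i j with rfl | hij
  · rw [rep_mul_self, one_pow]
  · by_cases h0 : Γ i j = 0
    · rw [h0, pow_zero]
    · exact (altProd_comm_iff (h.rep_mul_self i) (h.rep_mul_self j) _).1 (h.altProd_rep_comm hij h0)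

/-- The homomorphism `W_Γ → W_Γ'` that maps `s_i` to the longest element of `W_{T(i)}`. -/
noncomputable def hom (h : Γ.IsBurst hΓ N Γ' p) : Γ.Group →* Γ'.Group :=
  Γ.toCoxeterSystem.lift ⟨h.rep, h.isLiftable_rep⟩

theorem hom_simple (h : Γ.IsBurst hΓ N Γ' p) (i : I) : h.hom (Γ.simple i) = h.rep i :=
  Γ.toCoxeterSystem.lift_apply_simple h.isLiftable_rep i

theorem foldedGroup_le_range (h : Γ.IsBurst hΓ N Γ' p) :
    Γ'.foldedGroup (Set.range (burstFiber p)) ≤ h.hom.range := by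
  rw [foldedGroup, Subgroup.closure_le]
  rintro _ ⟨_, ⟨i, rfl⟩, rfl⟩
  exact ⟨Γ.simple i, h.hom_simple i⟩

theorem act_hom_pos (h : Γ.IsBurst hΓ N Γ' p) {u : Γ.Group} {i : I}
    (hi : Γ.len u < Γ.len (u * Γ.simple i)) {x : V} (hx : p x = i) :
    0 < Γ'.act h.isSimplyLaced (h.hom u)⁻¹ 1 x := by
  rw [← map_inv]
  refine Γ.pos_of_ascent ((Γ'.act h.isSimplyLaced).comp h.hom) p ?_ (fun _ => one_pos) hi hx
  intro i j hij k hk f hf x hx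
  rw [MonoidHom.comp_apply, map_inv, map_altProd, hom_simple, hom_simple]
  exact h.act_altProd_rep_pos hij hk hf hx

theorem act_hom_neg (h : Γ.IsBurst hΓ N Γ' p) {u : Γ.Group} {i : I}
    (hi : Γ.len (u * Γ.simple i) < Γ.len u) {x : V} (hx : p x = i) :
    Γ'.act h.isSimplyLaced (h.hom u)⁻¹ 1 x < 0 := by
  have := h.act_hom_pos (u := u * Γ.simple i) (by rwa [mul_simple_cancel]) hx
  rw [map_mul, hom_simple, mul_inv_rev, inv_rep, map_mul, Equiv.Perm.mul_apply, act_rep,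
    fire_of_mem _ _ (h.mem_fiber.2 hx)] at this
  omega

/-! ### Admissibility and the type -/

theorem isPartition (h : Γ.IsBurst hΓ N Γ' p) :
    Setoid.IsPartition (Set.range (burstFiber p)) := by
  refine ⟨?_, fun x => ⟨burstFiber p (p x), ⟨⟨p x, rfl⟩, rfl⟩, ?_⟩⟩
  · rintro ⟨i, hi⟩
    exact (h.nonempty_fiber i).ne_empty hi
  · rintro _ ⟨⟨i, rfl⟩, hx⟩
    exact congrArg _ (show p x = i from hx).symm

theorem isAdmissible (h : Γ.IsBurst hΓ N Γ' p) :
    Γ'.IsAdmissible (Set.range (burstFiber p)) := by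
  refine ⟨⟨h.isPartition, ?_⟩, ?_⟩
  · rintro _ ⟨i, rfl⟩
    exact h.isSpherical_fiber i
  · rintro w hw _ ⟨i, rfl⟩
    obtain ⟨u, rfl⟩ := h.foldedGroup_le_range hw
    rcases Γ.len_mul_simple u i with hi | hi
    · exact Or.inl fun x hx => h.isSimplyLaced.mem_ascents (h.act_hom_pos (by omega) hx)
    · exact Or.inr fun x hx => h.isSimplyLaced.mem_descents (h.act_hom_neg (by omega) hx)

/-- Otherwise the alternating products ending in `r_{T(j)}` and in `r_{T(i)}` would agree. On `T(i)`
the former gives positive values; the latter fires `T(i)` last and gives negative ones. -/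
theorem pow_rep_mul_rep_ne_one (h : Γ.IsBurst hΓ N Γ' p) {i j : I} (hij : i ≠ j) {k : ℕ}
    (hk0 : 0 < k) (hk : Γ i j = 0 ∨ k < Γ i j) : (h.rep i * h.rep j) ^ k ≠ 1 := by
  rw [Ne, ← altProd_comm_iff (h.rep_mul_self i) (h.rep_mul_self j)]
  intro heq
  obtain ⟨x, hx⟩ := h.nonempty_fiber i
  have hpos := h.act_altProd_rep_pos hij hk (f := 1) (fun _ _ => one_pos) hx
  obtain ⟨k, rfl⟩ : ∃ l, k = l + 1 := ⟨k - 1, by omega⟩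
  have hpos' := h.act_altProd_rep_pos hij (k := k) (hk.imp_right (by omega)) (f := 1)
    (fun _ _ => one_pos) hx
  rw [heq, altProd, mul_inv_rev, inv_rep, map_mul, Equiv.Perm.mul_apply, act_rep,
    fire_of_mem _ _ (h.mem_fiber.2 hx)] at hpos
  omega

theorem orderOf_rep_mul_rep (h : Γ.IsBurst hΓ N Γ' p) (i j : I) :
    orderOf (h.rep i * h.rep j) = Γ i j := by
  rcases eq_or_ne i j with rfl | hij
  · rw [rep_mul_self, orderOf_one, diagonal]
  · by_cases h0 : Γ i j = 0
    · rw [h0, orderOf_eq_zero_iff']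
      exact fun k hk => h.pow_rep_mul_rep_ne_one hij hk (.inl h0)
    · rw [orderOf_eq_iff (Nat.pos_of_ne_zero h0)]
      exact ⟨h.isLiftable_rep i j, fun k hk hk0 => h.pow_rep_mul_rep_ne_one hij hk0 (.inr hk)⟩

theorem burstFiber_injective (h : Γ.IsBurst hΓ N Γ' p) : Function.Injective (burstFiber p) := by
  intro i j hij
  obtain ⟨x, hx⟩ := h.nonempty_fiber i
  have hx' : x ∈ burstFiber p j := hij ▸ hx
  exact (show p x = i from hx).symm.trans hx'

end IsBurst

end CoxeterMatrix

theorem theorem3p13 {I V : Type*} (Γ : CoxeterMatrix I) (hΓ : Γ.labels.Finite) (N : ℕ)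
    (Γ' : CoxeterMatrix V) (p : V → I) (hburst : Γ.IsBurst hΓ N Γ' p) :
    Γ'.IsAdmissible (Set.range (CoxeterMatrix.burstFiber p)) ∧
      ∃ e : I ≃ ↥(Set.range (CoxeterMatrix.burstFiber p)),
        (∀ i, (e i : Set V) = CoxeterMatrix.burstFiber p i) ∧
        ∀ i j, Γ'.partitionType (Set.range (CoxeterMatrix.burstFiber p)) (e i) (e j) = Γ i j :=
  ⟨hburst.isAdmissible, Equiv.ofInjective _ hburst.burstFiber_injective, fun _ => rfl,
    hburst.orderOf_rep_mul_rep⟩
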